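/- Let $\Gamma$ be a discrete group, with identity $e$, and let $\mathrm{C}^*(\Gamma)$ be its universal group C*-algebra with canonical unitary generators $\delta_s$, $s\in\Gamma$. A positivity domain is a subset $\Delta\subseteq\Gamma$ with $e\in\Delta$ and $\Delta^{-1}=\Delta$. An element of $\mathrm{M}_n(\mathrm{C}^*(\Gamma))$ is supported on $S\subseteq\Gamma$ if it is of the form $\sum_{s} A_s\otimes\delta_s$ with finitely many $s\in S$ and $A_s\in \mathrm{M}_n(\mathbb{C})$. A positivity domain $\Delta$ has the *complete factorisation property* if for every $n\in\mathbb{N}$, every $z\in \mathrm{M}_n(\mathrm{C}^*(\Gamma))^+$ supported on $\Delta$ and every $\varepsilon>0$ there exist $r\in\mathbb{N}$, finite subsets $\Sigma_1,\dots,\Sigma_r\subseteq\Gamma$ with $\Sigma_i\Sigma_i^{-1}\subseteq\Delta$, and elements $y_i\in \mathrm{M}_n(\mathrm{C}^*(\Gamma))$ supported on $\Sigma_i$ such that $$z+\varepsilon\,\delta_e\otimes \mathbf 1_n=\sum_{i=1}^r y_iy_i^*.$$ A function $u:\Delta\to \mathrm{M}_n(\mathbb{C})$ is positive semi-definite if the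 block matrix $(u(st^{-1}))_{s,t\in\Sigma}$ is positive semi-definite for every finite $\Sigma\subseteq\Gamma$ with $\Sigma\Sigma^{-1}\subseteq\Delta$. The positivity domain $\Delta$ has the *complete extension property* if for every $n\in\mathbb{N}$ every positive semi-definite function $u:\Delta\to \mathrm{M}_n(\mathbb{C})$ extends to a positive semi-definite function $\Gamma\to \mathrm{M}_n(\mathbb{C})$. **Corollary.** The positivity domain $\Delta=\{(0,0),(0,\pm1),(\pm1,0)\}\subseteq\mathbb{Z}^2$ does not have the complete factorisation property, and it does not have the complete extension property. -/

import Mathlib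

open scoped ENNReal ComplexOrder

universe u

/-- A unitary representation of a discrete group on a nonzero complex Hilbert space. (Each cyclic
representation of `Γ : Type u` lives, up to unitary equivalence, on a space in `Type u`.) -/
structure UnitaryRep (Γ : Type u) [Group Γ] where
  H : Type u
  [normed : NormedAddCommGroup H]
  [innerProduct : InnerProductSpace ℂ H]
  [complete : CompleteSpace H]
  [nontrivial : Nontrivial H]
  π : Γ →* unitary (H →L[ℂ] H)

attribute [instance] UnitaryRep.normed UnitaryRep.innerProduct UnitaryRep.complete
  UnitaryRep.nontrivial

section GroupCStarAlgebra

variable (Γ : Type u) [Group Γ]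

/-- Bounded families of operators `(T_ρ)_ρ`, indexed by all unitary representations `ρ` of `Γ`,
with pointwise operations and the supremum norm: a C*-algebra. -/
abbrev UnivOps : Type (u + 1) :=
  lp (fun ρ : UnitaryRep.{u} Γ => ρ.H →L[ℂ] ρ.H) ∞

variable {Γ}

lemma memℓp_rep (s : Γ) :
    Memℓp (fun ρ : UnitaryRep.{u} Γ => ((ρ.π s : ρ.H →L[ℂ] ρ.H))) ∞ := by
  refine memℓp_infty ⟨1, ?_⟩
  rintro _ ⟨ρ, rfl⟩
  exact (CStarRing.norm_coe_unitary (ρ.π s)).le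

/-- The family of unitaries `(ρ(s))_ρ`, where `ρ` runs over all unitary representations. -/
noncomputable def univUnitary (s : Γ) : UnivOps Γ := ⟨fun ρ => (ρ.π s : ρ.H →L[ℂ] ρ.H), memℓp_rep s⟩

variable (Γ)

/-- The universal (full) group C*-algebra `C*(Γ)`: the closed *-subalgebra generated by the
universal unitary representation of `Γ`. Hence the norm of `∑ a_s δ_s` is the supremum of
`‖∑ a_s ρ(s)‖` over all unitary representations `ρ`. -/
noncomputable def groupCStarSubalgebra : StarSubalgebra ℂ (UnivOps Γ) :=
  (StarAlgebra.adjoin ℂ (Set.range (univUnitary (Γ := Γ)))).topologicalClosure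

/-- `C*(Γ)` as a type. -/
def GroupCStar : Type (u + 1) := groupCStarSubalgebra Γ

/-- The C*-algebra structure of `C*(Γ)`, as a closed *-subalgebra of the C*-algebra of bounded
families. -/
noncomputable def groupCStarStructure : CStarAlgebra (GroupCStar Γ) :=
  letI : CStarAlgebra (UnivOps Γ) := { }
  StarSubalgebra.cstarAlgebra (groupCStarSubalgebra Γ)
    (h_closed := StarSubalgebra.isClosed_topologicalClosure _)

noncomputable instance groupCStarAlgebra : CStarAlgebra (GroupCStar Γ) := groupCStarStructure Γ

variable {Γ}

/-- The canonical unitary generators `δ_s` of `C*(Γ)`. -/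
noncomputable def GroupCStar.δ (s : Γ) : GroupCStar Γ :=
  ⟨univUnitary s, StarSubalgebra.le_topologicalClosure _
    (StarAlgebra.subset_adjoin ℂ _ (Set.mem_range_self s))⟩

/-- `x ∈ M_n(C*(Γ))⁺`: positive elements of the C*-algebra `M_n(C*(Γ))` are those of the form
`b* b`; the involution on matrices is the conjugate transpose. -/
def MatrixPos {n : ℕ} (x : Matrix (Fin n) (Fin n) (GroupCStar Γ)) : Prop :=
  ∃ b : Matrix (Fin n) (Fin n) (GroupCStar Γ), x = star b * b

/-- `x ∈ M_n(C*(Γ))` is finitely supported inside `S`: every entry is a (finite) linear combination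
of the `δ_s`, `s ∈ S`. -/
def SupportedOn {n : ℕ} (S : Set Γ) (x : Matrix (Fin n) (Fin n) (GroupCStar Γ)) : Prop :=
  ∀ i j, x i j ∈ Submodule.span ℂ (GroupCStar.δ '' S)

end GroupCStarAlgebra

/-- A positivity domain: a symmetric subset containing the identity. -/
structure PositivityDomain (Γ : Type u) [Group Γ] where
  carrier : Set Γ
  one_mem : 1 ∈ carrier
  inv_mem : ∀ s ∈ carrier, s⁻¹ ∈ carrier

namespace PositivityDomain

variable {Γ : Type u} [Group Γ]

/-- `Σ Σ⁻¹ ⊆ S`. -/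
def DiffsIn (F : Finset Γ) (S : Set Γ) : Prop :=
  ∀ s ∈ F, ∀ t ∈ F, s * t⁻¹ ∈ S

/-- The complete factorisation property: for every `n`, every positive `z ∈ M_n(C*(Γ))` with finite
support inside `Δ`, and every `ε > 0`, the element `z + ε (δ_e ⊗ 1_n)` is a finite sum `∑ y_i y_i*`
with `y_i` supported on a finite set `Σ_i` with `Σ_i Σ_i⁻¹ ⊆ Δ`. -/
def CompleteFactorisationProperty (Δ : PositivityDomain Γ) : Prop :=
  ∀ (n : ℕ) (z : Matrix (Fin n) (Fin n) (GroupCStar Γ)),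
    MatrixPos z → SupportedOn Δ.carrier z →
    ∀ ε : ℝ, 0 < ε →
      ∃ (r : ℕ) (F : Fin r → Finset Γ) (y : Fin r → Matrix (Fin n) (Fin n) (GroupCStar Γ)),
        (∀ i, DiffsIn (F i) Δ.carrier) ∧
        (∀ i, SupportedOn (F i : Set Γ) (y i)) ∧
        z + (ε : ℂ) • Matrix.diagonal (fun _ : Fin n => GroupCStar.δ (1 : Γ)) =
          ∑ i, y i * star (y i)

/-- A function `u : S → M_n` is positive semi-definite: the block matrix `(u(st⁻¹))_{s,t ∈ Σ}` is
positive semi-definite for every finite `Σ ⊆ Γ` with `Σ Σ⁻¹ ⊆ S`. -/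
def IsPosSemidefFun {n : ℕ} (S : Set Γ) (f : S → Matrix (Fin n) (Fin n) ℂ) : Prop :=
  ∀ (F : Finset Γ) (hF : DiffsIn F S),
    (Matrix.of fun p q : F × Fin n =>
      f ⟨(p.1 : Γ) * (q.1 : Γ)⁻¹, hF p.1 p.1.2 q.1 q.1.2⟩ p.2 q.2).PosSemidef

/-- The complete extension property: for every `n`, every positive semi-definite `u : Δ → M_n`
extends to a positive semi-definite function on `Γ`. -/
def CompleteExtensionProperty (Δ : PositivityDomain Γ) : Prop :=
  ∀ (n : ℕ) (f : Δ.carrier → Matrix (Fin n) (Fin n) ℂ), IsPosSemidefFun Δ.carrier f →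
    ∃ g : Γ → Matrix (Fin n) (Fin n) ℂ,
      IsPosSemidefFun Set.univ (fun s : (Set.univ : Set Γ) => g s) ∧
      ∀ s : Δ.carrier, g s = f s

/-- The set `{(0,0), (0,±1), (±1,0)}` in the group `ℤ²`, written multiplicatively. -/
def fivePoint : PositivityDomain (Multiplicative (ℤ × ℤ)) where
  carrier := Multiplicative.ofAdd ''
    ({(0, 0), (0, 1), (0, -1), (1, 0), (-1, 0)} : Set (ℤ × ℤ))
  one_mem := ⟨(0, 0), by simp, rfl⟩
  inv_mem := by
    rintro _ ⟨p, hp, rfl⟩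
    refine ⟨-p, ?_, rfl⟩
    simp only [Set.mem_insert_iff, Set.mem_singleton_iff] at hp ⊢
    rcases hp with rfl | rfl | rfl | rfl | rfl <;> simp

end PositivityDomain

/-! ### Canonical unitaries of C*(Γ) and evaluation at characters. -/

section GroupCStarAlgebra
variable {Γ : Type u} [Group Γ]

/-! Let f be 1 at the origin, σₓ at (±1,0) and σ_z at (0,±1). A set with differences in Δ lies on
one grid line, so it sees only one Pauli matrix, and f is positive semi-definite
(`isPosSemidefFun_pauliFun`). A positive semi-definite extension to ℤ² would be multiplicative where
its values are unitary (`IsPosSemidefFun.map_mul_of_unitary`), so σₓ and σ_z would commute.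

The same f obstructs factorisation. Pairing with f is nonnegative on every yy* with y supported on
an admissible set (`IsPosSemidefFun.sum_apply_mul_star_nonneg`). With X = u + u*, Y = v + v* for the
two generators, T = σ_z ⊗ Y + σₓ ⊗ X satisfies T² = X² + Y² ≤ 8, so 24 - 8T = (4 - T)² + (8 - T²) is
positive; yet its pairing with f is -16, and still negative after adding ε = 1. -/

lemma GroupCStar.δ_one : GroupCStar.δ (1 : Γ) = 1 :=
  Subtype.ext <| Subtype.ext <| funext fun ρ => by
    change ((ρ.π 1 : unitary (ρ.H →L[ℂ] ρ.H)) : ρ.H →L[ℂ] ρ.H) = 1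
    simp

lemma GroupCStar.δ_mul (s t : Γ) : GroupCStar.δ (s * t) = GroupCStar.δ s * GroupCStar.δ t :=
  Subtype.ext <| Subtype.ext <| funext fun ρ => by
    change ((ρ.π (s * t) : unitary (ρ.H →L[ℂ] ρ.H)) : ρ.H →L[ℂ] ρ.H) = ρ.π s * ρ.π t
    simp

lemma GroupCStar.star_δ (s : Γ) : star (GroupCStar.δ s) = GroupCStar.δ s⁻¹ :=
  Subtype.ext <| Subtype.ext <| funext fun ρ => by
    change star ((ρ.π s : unitary (ρ.H →L[ℂ] ρ.H)) : ρ.H →L[ℂ] ρ.H) =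
      (ρ.π s⁻¹ : unitary (ρ.H →L[ℂ] ρ.H))
    rw [map_inv, ← Unitary.star_eq_inv]; rfl

/-- The one-dimensional representation given by a unitary character. -/
noncomputable abbrev UnitaryRep.ofCharacter {Γ : Type} [Group Γ] (χ : Γ →* unitary ℂ) :
    UnitaryRep Γ where
  H := ℂ
  π := (Unitary.map (R := ℂ) (S := ℂ →L[ℂ] ℂ)
    (StarMonoidHom.ofClass (StarAlgHom.ofId ℂ (ℂ →L[ℂ] ℂ)))).toMonoidHom.comp χ

/-- Evaluation of elements of `C*(Γ)` at a unitary character. -/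
noncomputable def GroupCStar.eval {Γ : Type} [Group Γ] (χ : Γ →* unitary ℂ) :
    GroupCStar Γ →ₗ[ℂ] ℂ where
  toFun T := (show ℂ →L[ℂ] ℂ from T.1.1 (UnitaryRep.ofCharacter χ)) 1
  map_add' _ _ := rfl
  map_smul' _ _ := rfl

lemma GroupCStar.eval_δ {Γ : Type} [Group Γ] (χ : Γ →* unitary ℂ) (s : Γ) :
    GroupCStar.eval χ (GroupCStar.δ s) = χ s := by
  change (algebraMap ℂ (ℂ →L[ℂ] ℂ) (χ s)) 1 = _
  simp [Algebra.algebraMap_eq_smul_one]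

end GroupCStarAlgebra

/-! ### Consequences of positive semi-definiteness. -/

namespace PositivityDomain
variable {Γ : Type u} [Group Γ]

/-- A functional induced by a positive semi-definite function on `S` is nonnegative on `y y*` when
`y` is supported on a set with differences in `S`. -/
lemma IsPosSemidefFun.sum_apply_mul_star_nonneg {n m : ℕ} {S : Set Γ}
    {f : S → Matrix (Fin n) (Fin n) ℂ} (hf : IsPosSemidefFun S f)
    (φ : Fin n → Fin n → GroupCStar Γ →ₗ[ℂ] ℂ)
    (hφ : ∀ i j (s : S), φ i j (GroupCStar.δ (s : Γ)) = f s i j)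
    {F : Finset Γ} (hF : DiffsIn F S) (y : Matrix (Fin n) (Fin m) (GroupCStar Γ))
    (hy : ∀ i k, y i k ∈ Submodule.span ℂ (GroupCStar.δ '' (F : Set Γ))) :
    0 ≤ ∑ i, ∑ j, φ i j (∑ k, y i k * star (y j k)) := by
  simp only [Submodule.mem_span_image_finset_iff_exists_fun] at hy
  choose c hc using hy
  have hterm : ∀ i j k, φ i j (y i k * star (y j k)) =
      ∑ s : F, ∑ t : F, c i k s * star (c j k t) * f ⟨(s : Γ) * (t : Γ)⁻¹, hF s s.2 t t.2⟩ i j := by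
    intro i j k
    rw [← hc i k, ← hc j k, star_sum, Finset.sum_mul_sum, map_sum]
    refine Finset.sum_congr rfl fun s _ => ?_
    rw [map_sum]
    refine Finset.sum_congr rfl fun t _ => ?_
    rw [star_smul, smul_mul_smul_comm, GroupCStar.star_δ, ← GroupCStar.δ_mul, map_smul, smul_eq_mul]
    exact congrArg _ (hφ i j ⟨(s : Γ) * (t : Γ)⁻¹, hF s s.2 t t.2⟩)
  have hpos : ∀ k, 0 ≤ ∑ i, ∑ j, φ i j (y i k * star (y j k)) := by
    intro k
    -- The contribution of column k of y is the quadratic form of the block matrix of f at that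
    -- column's conjugated coefficients.
    have h := (hf F hF).dotProduct_mulVec_nonneg (fun p => star (c p.2 k p.1))
    refine h.trans_eq ?_
    simp only [dotProduct, Matrix.mulVec, Fintype.sum_prod_type_right, hterm, Pi.star_apply,
      star_star, Finset.mul_sum, Matrix.of_apply]
    refine Finset.sum_congr rfl fun i _ => ?_
    rw [Finset.sum_comm]
    refine Finset.sum_congr rfl fun j _ => Finset.sum_congr rfl fun s _ =>
      Finset.sum_congr rfl fun t _ => by ring
  simp only [map_sum]
  refine (Finset.sum_nonneg (s := Finset.univ) fun k _ => hpos k).trans_eq ?_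
  rw [Finset.sum_comm]
  exact Finset.sum_congr rfl fun i _ => Finset.sum_comm

/-- A unital positive semi-definite function is multiplicative at points where it is unitary. -/
lemma IsPosSemidefFun.map_mul_of_unitary {n : ℕ} {g : Γ → Matrix (Fin n) (Fin n) ℂ}
    (hg : IsPosSemidefFun Set.univ (fun s : (Set.univ : Set Γ) => g s)) (h1 : g 1 = 1)
    {s : Γ} (hs : g s ∈ unitary (Matrix (Fin n) (Fin n) ℂ)) (t : Γ) :
    g (t * s) = g t * g s := by
  classical
  obtain ⟨hs1, hs2⟩ := Unitary.mem_iff.1 hs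
  let F : Finset Γ := {1, s, t * s}
  have hF : DiffsIn F Set.univ := fun _ _ _ _ => trivial
  have hK := hg F hF
  let e : F := ⟨1, by simp [F]⟩
  let a : F := ⟨s, by simp [F]⟩
  let b : F := ⟨t * s, by simp [F]⟩
  have hinv : g s⁻¹ = star (g s) := by
    ext i j
    have := hK.isHermitian.apply (e, i) (a, j)
    simpa [e, a, Matrix.star_apply] using this.symm
  have key : g (t * s) * star (g s) = g t := by
    ext i j
    -- Row r of the block matrix sends x to column j of g(rs⁻¹) - g(r)g(s)*. This vanishes for r = 1
    -- and r = s, the only places where x is supported, so x is isotropic and hence in the kernel;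
    -- row ts then gives the claim.
    let x : F × Fin n → ℂ := fun p =>
      (if p.1 = a then (1 : Matrix (Fin n) (Fin n) ℂ) p.2 j else 0) -
        if p.1 = e then star (g s) p.2 j else 0
    have hmul : ∀ (r : F) (l : Fin n), Matrix.mulVec (Matrix.of fun p q : F × Fin n =>
        g ((p.1 : Γ) * (q.1 : Γ)⁻¹) p.2 q.2) x (r, l) =
        g (r * s⁻¹) l j - (g r * star (g s)) l j := by
      intro r l
      simp [Matrix.mulVec, dotProduct, x, Fintype.sum_prod_type_right, mul_sub, a, e,
        Finset.sum_sub_distrib, Matrix.mul_apply, Matrix.one_apply]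
    have hx : Matrix.mulVec (Matrix.of fun p q : F × Fin n =>
        g ((p.1 : Γ) * (q.1 : Γ)⁻¹) p.2 q.2) x = 0 := by
      rw [← hK.dotProduct_mulVec_zero_iff]
      refine Finset.sum_eq_zero fun ⟨r, l⟩ _ => ?_
      by_cases ha : r = a
      · refine mul_eq_zero_of_right _ ((hmul r l).trans ?_)
        simp [ha, a, h1, hs2]
      by_cases he : r = e
      · refine mul_eq_zero_of_right _ ((hmul r l).trans ?_)
        simp [he, e, h1, hinv]
      · refine mul_eq_zero_of_left ?_ _
        simp [x, ha, he]
    have := (hmul b i).symm.trans (congrFun hx (b, i))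
    exact (by simpa [b, sub_eq_zero] using this : g t i j = _).symm
  rw [← key, mul_assoc, hs1, mul_one]

end PositivityDomain

/-! ### The Pauli function and the failure of extension. -/

namespace PositivityDomain

/-- The Pauli matrix `σₓ`. -/
def pauliX : Matrix (Fin 2) (Fin 2) ℂ := !![0, 1; 1, 0]

/-- The Pauli matrix `σ_z`. -/
def pauliZ : Matrix (Fin 2) (Fin 2) ℂ := !![1, 0; 0, -1]

lemma pauliX_mul_self : pauliX * pauliX = 1 := by
  simp [pauliX, Matrix.one_fin_two]

lemma pauliZ_mul_self : pauliZ * pauliZ = 1 := by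
  simp [pauliZ, Matrix.one_fin_two]

lemma star_pauliX : star pauliX = pauliX := by
  ext i j; fin_cases i <;> fin_cases j <;> simp [pauliX, Matrix.star_apply]

lemma star_pauliZ : star pauliZ = pauliZ := by
  ext i j; fin_cases i <;> fin_cases j <;> simp [pauliZ, Matrix.star_apply]

/-- The function on `ℤ²` equal to `1` at the origin, to `σₓ` on the rest of the first axis, and to
`σ_z` elsewhere. -/
noncomputable def pauliFun (s : Multiplicative (ℤ × ℤ)) : Matrix (Fin 2) (Fin 2) ℂ :=
  if s.toAdd = 0 then 1 else if s.toAdd.2 = 0 then pauliX else pauliZ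

lemma mem_fivePoint {s : Multiplicative (ℤ × ℤ)} : s ∈ fivePoint.carrier ↔
    s.toAdd = (0, 0) ∨ s.toAdd = (0, 1) ∨ s.toAdd = (0, -1) ∨ s.toAdd = (1, 0) ∨
      s.toAdd = (-1, 0) := by
  constructor
  · rintro ⟨p, hp, rfl⟩
    exact hp
  · exact fun h => ⟨s.toAdd, h, rfl⟩

/-- A finite set with differences in `fivePoint` is horizontal or vertical. -/
lemma DiffsIn.fivePoint {F : Finset (Multiplicative (ℤ × ℤ))}
    (hF : DiffsIn F fivePoint.carrier) :
    (∀ s ∈ F, ∀ t ∈ F, s.toAdd.2 = t.toAdd.2) ∨ (∀ s ∈ F, ∀ t ∈ F, s.toAdd.1 = t.toAdd.1) := by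
  have h : ∀ s ∈ F, ∀ t ∈ F, s.toAdd.1 = t.toAdd.1 ∨ s.toAdd.2 = t.toAdd.2 := by
    intro s hs t ht
    have := mem_fivePoint.1 (hF s hs t ht)
    simp only [toAdd_mul, toAdd_inv, Prod.ext_iff, Prod.fst_add, Prod.snd_add, Prod.fst_neg,
      Prod.snd_neg] at this
    omega
  by_contra! hcon
  obtain ⟨⟨s, hs, t, ht, hst⟩, s', hs', t', ht', hst'⟩ := hcon
  have := h s hs t ht
  have := h s' hs' t' ht'
  have := h s hs s' hs'
  have := h s hs t' ht'
  have := h t ht s' hs'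
  have := h t ht t' ht'
  omega

/-- The block matrix is R R*, where R stacks the blocks ρ(s); ρ may depend on the finite set. -/
lemma isPosSemidefFun_of_gram {Γ : Type u} [Group Γ] {n : ℕ} {S : Set Γ}
    {f : S → Matrix (Fin n) (Fin n) ℂ}
    (h : ∀ (F : Finset Γ) (hF : DiffsIn F S), ∃ ρ : Γ → Matrix (Fin n) (Fin n) ℂ,
      ∀ (s : Γ) (hs : s ∈ F) (t : Γ) (ht : t ∈ F),
        f ⟨s * t⁻¹, hF s hs t ht⟩ = ρ s * star (ρ t)) :
    IsPosSemidefFun S f := by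
  intro F hF
  obtain ⟨ρ, hρ⟩ := h F hF
  convert Matrix.posSemidef_self_mul_conjTranspose
    (Matrix.of fun (p : F × Fin n) (k : Fin n) => ρ p.1 p.2 k) using 1
  ext p q
  simp only [Matrix.of_apply, hρ p.1 p.1.2 q.1 q.1.2]
  rfl

lemma isPosSemidefFun_pauliFun :
    IsPosSemidefFun fivePoint.carrier (fun s : fivePoint.carrier => pauliFun s) := by
  refine isPosSemidefFun_of_gram fun F hF => ?_
  rcases hF.fivePoint with h | h
  -- Differences along the line are 0 or ±1, so they are determined up to sign by parity, and σₓ is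
  -- a self-adjoint involution.
  · refine ⟨fun s => if Even s.toAdd.1 then 1 else pauliX, fun s hs t ht => ?_⟩
    have h2 := h s hs t ht
    have hd := mem_fivePoint.1 (hF s hs t ht)
    simp only [toAdd_mul, toAdd_inv, Prod.ext_iff, Prod.fst_add, Prod.snd_add, Prod.fst_neg,
      Prod.snd_neg] at hd
    have h0 : s.toAdd.2 + -t.toAdd.2 = 0 := by omega
    simp only [pauliFun, toAdd_mul, toAdd_inv, Prod.ext_iff, Prod.fst_add, Prod.snd_add,
      Prod.fst_neg, Prod.snd_neg, Prod.fst_zero, Prod.snd_zero, h0, and_true, if_true]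
    split_ifs with a b c c b c c <;> rw [Int.even_iff] at * <;> first
      | omega
      | simp [star_pauliX, pauliX_mul_self]
  · refine ⟨fun s => if Even s.toAdd.2 then 1 else pauliZ, fun s hs t ht => ?_⟩
    have h2 := h s hs t ht
    have hd := mem_fivePoint.1 (hF s hs t ht)
    simp only [toAdd_mul, toAdd_inv, Prod.ext_iff, Prod.fst_add, Prod.snd_add, Prod.fst_neg,
      Prod.snd_neg] at hd
    have h0 : s.toAdd.1 + -t.toAdd.1 = 0 := by omega
    simp only [pauliFun, toAdd_mul, toAdd_inv, Prod.ext_iff, Prod.fst_add, Prod.snd_add,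
      Prod.fst_neg, Prod.snd_neg, Prod.fst_zero, Prod.snd_zero, h0, true_and]
    split_ifs with a b c c b c c <;> rw [Int.even_iff] at * <;> first
      | omega
      | simp [star_pauliZ, pauliZ_mul_self]

lemma not_completeExtensionProperty_fivePoint : ¬ fivePoint.CompleteExtensionProperty := by
  intro h
  obtain ⟨g, hg, hgf⟩ := h 2 _ isPosSemidefFun_pauliFun
  have h1 : g 1 = 1 :=
    (hgf ⟨1, fivePoint.one_mem⟩).trans (by simp [pauliFun])
  have hX : g (Multiplicative.ofAdd (1, 0)) = pauliX :=
    (hgf ⟨Multiplicative.ofAdd (1, 0), mem_fivePoint.2 (by simp)⟩).trans (by simp [pauliFun])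
  have hZ : g (Multiplicative.ofAdd (0, 1)) = pauliZ :=
    (hgf ⟨Multiplicative.ofAdd (0, 1), mem_fivePoint.2 (by simp)⟩).trans (by simp [pauliFun])
  have hXu : pauliX ∈ unitary (Matrix (Fin 2) (Fin 2) ℂ) := by
    simp [Unitary.mem_iff, star_pauliX, pauliX_mul_self]
  have hZu : pauliZ ∈ unitary (Matrix (Fin 2) (Fin 2) ℂ) := by
    simp [Unitary.mem_iff, star_pauliZ, pauliZ_mul_self]
  have hXZ := hg.map_mul_of_unitary h1 (hZ ▸ hZu) (Multiplicative.ofAdd (1, 0))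
  have hZX := hg.map_mul_of_unitary h1 (hX ▸ hXu) (Multiplicative.ofAdd (0, 1))
  rw [mul_comm, hZX, hX, hZ] at hXZ
  have := congrFun (congrFun hXZ 0) 1
  norm_num [pauliX, pauliZ, Complex.ext_iff] at this

end PositivityDomain

/-! ### A positive element supported on the five points. -/

namespace PositivityDomain

/-- A sum of squares decomposition of `24 - 8 (σ_z ⊗ Y + σₓ ⊗ X)`, where `X = u + u*` and
`Y = v + v*` for commuting unitaries `u` and `v`. -/
lemma exists_star_mul_self_eq_of_commute_unitary {A : Type*} [Ring A] [StarRing A] [Algebra ℂ A]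
    [StarModule ℂ A] {u v : A} (hu : u ∈ unitary A) (hv : v ∈ unitary A) (huv : u * v = v * u)
    (huv' : u * star v = star v * u) :
    ∃ b : Matrix (Fin 4) (Fin 4) A, star b * b =
      !![24 - 8 * (v + star v), -(8 * (u + star u)), 0, 0;
        -(8 * (u + star u)), 24 + 8 * (v + star v), 0, 0;
        0, 0, 0, 0;
        0, 0, 0, 0] := by
  obtain ⟨hu1, hu2⟩ := Unitary.mem_iff.1 hu
  obtain ⟨hv1, hv2⟩ := Unitary.mem_iff.1 hv
  have huv2 : star u * v = v * star u := by simpa using (congrArg star huv').symm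
  have huv3 : star u * star v = star v * star u := by simpa using (congrArg star huv).symm
  obtain ⟨X, hX⟩ : ∃ X, X = u + star u := ⟨_, rfl⟩
  obtain ⟨Y, hY⟩ : ∃ Y, Y = v + star v := ⟨_, rfl⟩
  obtain ⟨P, hP⟩ : ∃ P, P = u - star u := ⟨_, rfl⟩
  obtain ⟨Q, hQ⟩ : ∃ Q, Q = v - star v := ⟨_, rfl⟩
  have sX : star X = X := by simp [hX, add_comm]
  have sY : star Y = Y := by simp [hY, add_comm]
  have sP : star P = -P := by simp [hP]
  have sQ : star Q = -Q := by simp [hQ]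
  have hXY : X * Y = Y * X := by
    simp only [hX, hY, mul_add, add_mul, huv, huv', huv2, huv3]; abel
  have hPQ : P * Q = Q * P := by
    simp only [hP, hQ, mul_sub, sub_mul, huv, huv', huv2, huv3]; abel
  have hXP : P * P = X * X - 4 := by
    have h4 : (4 : A) = 1 + 1 + 1 + 1 := by norm_num
    simp only [hX, hP, mul_add, add_mul, mul_sub, sub_mul, hu1, hu2, h4]; abel
  have hYQ : Q * Q = Y * Y - 4 := by
    have h4 : (4 : A) = 1 + 1 + 1 + 1 := by norm_num
    simp only [hY, hQ, mul_add, add_mul, mul_sub, sub_mul, hv1, hv2, h4]; abel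
  -- Since P*P = 4 - X² and Q*Q = 4 - Y², and the cross terms cancel, W is a square root of 8 - X² -
  -- Y².
  obtain ⟨W, hW⟩ : ∃ W, W = P + Complex.I • Q := ⟨_, rfl⟩
  have hWW : star W * W = 8 - X * X - Y * Y := by
    have h8 : (8 : A) = 4 + 4 := by norm_num
    simp only [hW, star_add, star_smul, sP, sQ, mul_add, add_mul, smul_mul_assoc, mul_smul_comm,
      neg_mul, smul_neg, smul_add, smul_sub, smul_smul, hPQ, hXP, hYQ, h8, Complex.star_def, Complex.conj_I, neg_smul,
      neg_neg, Complex.I_mul_I, one_smul]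
    abel
  have h44 : (4 : A) * 4 = 24 - 8 := by norm_num
  rw [← hX, ← hY]
  -- The blocks 4 - T and W ⊗ 1 are stacked into a 4 × 2 matrix; zero columns make it square.
  refine ⟨!![4 - Y, -X, 0, 0; -X, 4 + Y, 0, 0; W, 0, 0, 0; 0, W, 0, 0], ?_⟩
  ext i j
  rw [Matrix.mul_apply, Fin.sum_univ_four]
  fin_cases i <;> fin_cases j <;>
    simp [Matrix.star_apply, sX, sY, hWW] <;> noncomm_ring <;> simp [hXY, h44] <;> abel

end PositivityDomain

/-! ### The failure of factorisation. -/

namespace PositivityDomain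

/-- The character of `ℤ²` with values `a` and `b` on the standard generators. -/
noncomputable def intProdCharacter (a b : unitary ℂ) : Multiplicative (ℤ × ℤ) →* unitary ℂ where
  toFun s := a ^ s.toAdd.1 * b ^ s.toAdd.2
  map_one' := by simp
  map_mul' s t := by
    simp only [toAdd_mul, Prod.fst_add, Prod.snd_add, zpow_add]
    exact mul_mul_mul_comm _ _ _ _

/-- Characters with values ±1 do not distinguish s from s⁻¹; their combinations φ₀, φX, φZ pick out
the coefficients at the origin and on the two axes of Δ. Only linearity is needed. -/
lemma exists_linearMap_apply_δ_eq_pauliFun :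
    ∃ φ : Fin 2 → Fin 2 → GroupCStar (Multiplicative (ℤ × ℤ)) →ₗ[ℂ] ℂ,
      ∀ i j, ∀ s ∈ fivePoint.carrier, φ i j (GroupCStar.δ s) = pauliFun s i j := by
  let E (a b : unitary ℂ) := GroupCStar.eval (intProdCharacter a b)
  let φ₀ := (1 / 2 : ℂ) • (E 1 1 + E (-1) (-1))
  let φX := (1 / 2 : ℂ) • (E 1 1 - E (-1) 1)
  let φZ := (1 / 2 : ℂ) • (E 1 1 - E 1 (-1))
  refine ⟨fun i j => (1 : Matrix (Fin 2) (Fin 2) ℂ) i j • φ₀ + pauliX i j • φX +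
    pauliZ i j • φZ, fun i j s hs => ?_⟩
  have hneg : ((-1 : unitary ℂ) : ℂ) = -1 := rfl
  rcases mem_fivePoint.1 hs with h | h | h | h | h <;>
    norm_num [φ₀, φX, φZ, E, GroupCStar.eval_δ, intProdCharacter, pauliFun, h, hneg] <;> ring

lemma not_completeFactorisationProperty_fivePoint : ¬ fivePoint.CompleteFactorisationProperty := by
  intro h
  let d (m n : ℤ) := GroupCStar.δ (Multiplicative.ofAdd (m, n))
  have hunit : ∀ m n, d m n ∈ unitary (GroupCStar (Multiplicative (ℤ × ℤ))) := fun m n => by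
    simp [d, Unitary.mem_iff, GroupCStar.star_δ, ← GroupCStar.δ_mul, GroupCStar.δ_one]
  have hcomm : ∀ s t : Multiplicative (ℤ × ℤ),
      GroupCStar.δ s * GroupCStar.δ t = GroupCStar.δ t * GroupCStar.δ s := fun s t => by
    rw [← GroupCStar.δ_mul, mul_comm, GroupCStar.δ_mul]
  have hstar : ∀ m n, star (d m n) = d (-m) (-n) := fun m n => GroupCStar.star_δ _
  obtain ⟨b, hb⟩ := exists_star_mul_self_eq_of_commute_unitary (hunit 1 0) (hunit 0 1)
    (hcomm _ _) (by rw [hstar]; exact hcomm _ _)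
  have hd : d 0 0 = 1 := GroupCStar.δ_one
  have h24 : (24 : GroupCStar (Multiplicative (ℤ × ℤ))) = (24 : ℂ) • d 0 0 := by
    rw [hd, Algebra.smul_def, mul_one, map_ofNat]
  have h8 : ∀ x : GroupCStar (Multiplicative (ℤ × ℤ)), 8 * x = (8 : ℂ) • x := fun x => by
    rw [Algebra.smul_def, map_ofNat]
  simp only [h8, h24, hstar, neg_zero] at hb
  have hmem : ∀ m n, Multiplicative.ofAdd (m, n) ∈ fivePoint.carrier →
      d m n ∈ Submodule.span ℂ (GroupCStar.δ '' fivePoint.carrier) := fun m n hmn =>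
    Submodule.subset_span ⟨_, hmn, rfl⟩
  have m0 : Multiplicative.ofAdd ((0 : ℤ), (0 : ℤ)) ∈ fivePoint.carrier := by simp [mem_fivePoint]
  have m1 : Multiplicative.ofAdd ((1 : ℤ), (0 : ℤ)) ∈ fivePoint.carrier := by simp [mem_fivePoint]
  have m2 : Multiplicative.ofAdd ((-1 : ℤ), (0 : ℤ)) ∈ fivePoint.carrier := by simp [mem_fivePoint]
  have m3 : Multiplicative.ofAdd ((0 : ℤ), (1 : ℤ)) ∈ fivePoint.carrier := by simp [mem_fivePoint]
  have m4 : Multiplicative.ofAdd ((0 : ℤ), (-1 : ℤ)) ∈ fivePoint.carrier := by simp [mem_fivePoint]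
  have hX := (Submodule.smul_mem _ (8 : ℂ) (Submodule.add_mem _ (hmem _ _ m1) (hmem _ _ m2)))
  have hY := (Submodule.smul_mem _ (8 : ℂ) (Submodule.add_mem _ (hmem _ _ m3) (hmem _ _ m4)))
  have hI := (Submodule.smul_mem _ (24 : ℂ) (hmem _ _ m0))
  have hsupp : SupportedOn fivePoint.carrier (star b * b) := by
    rw [hb]
    intro i j
    fin_cases i <;> fin_cases j <;> first
      | exact Submodule.sub_mem _ hI hY
      | exact Submodule.add_mem _ hI hY
      | exact Submodule.neg_mem _ hX
      | exact Submodule.zero_mem _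
  obtain ⟨r, F, y, hF, hy, heq⟩ := h 4 _ ⟨b, rfl⟩ hsupp 1 one_pos
  obtain ⟨φ, hφ⟩ := exists_linearMap_apply_δ_eq_pauliFun
  -- The pairing uses the upper left 2 × 2 corner; the corner of yy* comes from the first two rows
  -- of y.
  let e : Fin 2 → Fin 4 := Fin.castLE (by norm_num)
  have hnonneg : 0 ≤ ∑ i, ∑ j, φ i j ((∑ l, y l * star (y l)) (e i) (e j)) := by
    have hl := Finset.sum_nonneg (s := Finset.univ) fun l _ =>
      isPosSemidefFun_pauliFun.sum_apply_mul_star_nonneg φ (fun i j s => hφ i j s s.2) (hF l)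
        ((y l).submatrix e id) fun i k => hy l (e i) k
    refine hl.trans_eq ?_
    simp only [Matrix.sum_apply, map_sum (φ _ _), Matrix.mul_apply, Matrix.star_apply,
      Matrix.submatrix_apply, id]
    rw [Finset.sum_comm]
    exact Finset.sum_congr rfl fun i _ => Finset.sum_comm
  have hφd : ∀ i j m n, Multiplicative.ofAdd (m, n) ∈ fivePoint.carrier →
      φ i j (d m n) = pauliFun (Multiplicative.ofAdd (m, n)) i j := fun i j m n hmn => hφ i j _ hmn
  rw [← heq, hb, show GroupCStar.δ (1 : Multiplicative (ℤ × ℤ)) = d 0 0 from rfl] at hnonneg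
  -- The diagonal entries give 8 + 8, the off-diagonal ones -16 - 16, and ε = 1 adds 2.
  have hneg : ∑ i, ∑ j, φ i j ((!![(24 : ℂ) • d 0 0 - (8 : ℂ) • (d 0 1 + d 0 (-1)),
      -((8 : ℂ) • (d 1 0 + d (-1) 0)), 0, 0;
      -((8 : ℂ) • (d 1 0 + d (-1) 0)), (24 : ℂ) • d 0 0 + (8 : ℂ) • (d 0 1 + d 0 (-1)), 0, 0;
      0, 0, 0, 0; 0, 0, 0, 0] +
      ((1 : ℝ) : ℂ) • Matrix.diagonal fun _ : Fin 4 => d 0 0) (e i) (e j)) = -14 := by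
    simp only [Fin.sum_univ_two, e]
    norm_num [hφd, m0, m1, m2, m3, m4, pauliFun, pauliX, pauliZ, Fin.castLE]
  rw [hneg] at hnonneg
  norm_num [Complex.le_def] at hnonneg

end PositivityDomain

theorem mainTheorem6 :
    ¬ PositivityDomain.fivePoint.CompleteFactorisationProperty ∧
    ¬ PositivityDomain.fivePoint.CompleteExtensionProperty :=
  ⟨PositivityDomain.not_completeFactorisationProperty_fivePoint,
    PositivityDomain.not_completeExtensionProperty_fivePoint⟩
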